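/- **Theorem (Consistency of Hill's estimator for random intermediate sequences).** Let $\alpha>0$ and let $F$ be a continuous distribution function supported on $[1,\infty)$ whose tail $\overline F=1-F$ is regularly varying with index $-\alpha$, that is, $\lim_{t\to\infty}\overline F(tx)/\overline F(t)=x^{-\alpha}$ for every $x>0$. Let $X_1,X_2,\ldots$ be independent random variables on a probability space $(\Omega,\mathcal A,\mathbb P)$ with common distribution function $F$, and let $X_{1:n}\le\cdots\le X_{n:n}$ be the order statistics of $X_1,\ldots,X_n$. For $1\le k\le n-1$, Hill's estimator is $$\widehat\alpha_{n,k}=H_{n,k}^{-1}=\Big(\frac1k\sum_{i=1}^{k}\log\frac{X_{n-k+i:n}}{X_{n-k:n}}\Big)^{-1}.$$ Let $(k_n)_{n\ge1}$ be a random intermediate sequence, that is, a sequence of $\mathbb N$-valued random variables on $(\Omega,\mathcal A,\mathbb P)$, which may depend on the data in an arbitrary way, such that $k_n\to\infty$ in probability (i.e. $\mathbb P(k_n\le M)\to0$ for every $M$) and $k_n/n\to0$ in probability. Then $\widehat\alpha_{n,k_n}\to\alpha$ in probability as $n\to\infty$. (The probability that $1\le k_n\le n-1$ tends to $1$, so the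 value given to $\widehat\alpha_{n,k}$ for other $k$ is immaterial.) -/

import Mathlib

open MeasureTheory ProbabilityTheory Filter Topology

noncomputable section

/-- `G` is regularly varying (at infinity) with index `ρ`. If `G` vanishes at arbitrarily large
arguments this fails, because the limit `x ^ ρ` is positive. -/
def IsRegularlyVarying (G : ℝ → ℝ) (ρ : ℝ) : Prop :=
  ∀ x : ℝ, 0 < x → Tendsto (fun t : ℝ => G (t * x) / G t) atTop (𝓝 (x ^ ρ))

/-- The tail (survival) function `1 - F` of a probability measure on `ℝ` with distribution
function `F`. -/
def tailFunction (ν : Measure ℝ) (t : ℝ) : ℝ := 1 - cdf ν t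

/-- The order statistic `x_{j:n}`, i.e. the `j`-th smallest entry (`1 ≤ j ≤ n`, counted with
multiplicity) of a sample of size `n`. The value `0` outside this range is a convention. -/
def orderStatistic {n : ℕ} (x : Fin n → ℝ) (j : ℕ) : ℝ :=
  if h : 1 ≤ j ∧ j ≤ n then x (Tuple.sort x ⟨j - 1, by omega⟩) else 0

/-- The Hill statistic `H_{n,k} = (1/k) ∑_{i=1}^k log (x_{n-k+i:n} / x_{n-k:n})`. It is only
meaningful for `1 ≤ k ≤ n - 1`. -/
def hillStatistic {n : ℕ} (x : Fin n → ℝ) (k : ℕ) : ℝ :=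
  (1 / (k : ℝ)) * ∑ i ∈ Finset.Icc 1 k,
    Real.log (orderStatistic x (n - k + i) / orderStatistic x (n - k))

/-- Hill's estimator `α̂_{n,k} = 1 / H_{n,k}`. -/
def hillEstimator {n : ℕ} (x : Fin n → ℝ) (k : ℕ) : ℝ := (hillStatistic x k)⁻¹

/-- A sequence of `ℕ`-valued functions on a probability space tends to infinity in probability
and is `o(n)` in probability. -/
structure IsRandomIntermediate {Ω : Type*} [MeasurableSpace Ω] (P : Measure Ω)
    (k : ℕ → Ω → ℕ) : Prop where
  tendsto_infty : ∀ M : ℕ, Tendsto (fun n => P {ω | k n ω ≤ M}) atTop (𝓝 0)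
  tendsto_zero : TendstoInMeasure P (fun n ω => (k n ω : ℝ) / (n : ℝ)) atTop (fun _ => 0)

end

/-! Large deviations of the Hill statistic decay geometrically in `k`, uniformly in `n`. Given a
threshold `u`, the log-excesses over `u` are independent, with the law of `log (X / u)` conditioned
on `X > u`. Regular variation yields, for every `u ≥ u₀`, a Chernoff factor `ρ < 1` for exceeding
mean `1 / α + δ`, and another for falling below `1 / α - δ` (`exists_chernoff_bound_upper`,
`exists_chernoff_bound_lower`). So a `δ`-deviation using `k` excesses over a threshold at least `u₀`
has probability at most `ρ ^ k` on each side (`measure_logExcessDeviationSet_le`).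

Since `∑ ρ ^ k` converges, with high probability no `k ≥ M` is bad, whatever `n`. This control is
simultaneous in `k`, so it covers a data-dependent `k n`. The threshold does exceed `u₀`, because `k
n / n → 0` while the proportion of the sample above `u₀` tends to a positive number. -/

/-! ### Tail function -/

theorem measure_Ioi_eq_tailFunction (ν : Measure ℝ) [IsProbabilityMeasure ν] (u : ℝ) :
    ν (Set.Ioi u) = ENNReal.ofReal (tailFunction ν u) := by
  conv_lhs => rw [← measure_cdf ν]
  exact StieltjesFunction.measure_Ioi _ (tendsto_cdf_atTop ν) u

theorem measure_Ioc_eq_tailFunction_sub (ν : Measure ℝ) [IsProbabilityMeasure ν] (a b : ℝ) :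
    ν (Set.Ioc a b) = ENNReal.ofReal (tailFunction ν a - tailFunction ν b) := by
  conv_lhs => rw [← measure_cdf ν]
  rw [StieltjesFunction.measure_Ioc]
  simp [tailFunction]

theorem tailFunction_nonneg (ν : Measure ℝ) [IsProbabilityMeasure ν] (u : ℝ) :
    0 ≤ tailFunction ν u := sub_nonneg.2 (cdf_le_one ν u)

theorem tailFunction_antitone (ν : Measure ℝ) [IsProbabilityMeasure ν] :
    Antitone (tailFunction ν) := fun _ _ h => sub_le_sub_left (monotone_cdf ν h) 1

theorem tailFunction_pos {ν : Measure ℝ} [IsProbabilityMeasure ν] {ρ : ℝ}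
    (hRV : IsRegularlyVarying (tailFunction ν) ρ) (u : ℝ) : 0 < tailFunction ν u := by
  refine (tailFunction_nonneg ν u).lt_of_ne' fun h => ?_
  have h1 := hRV 1 one_pos
  -- Past a zero of the tail the quotient is `0 / 0 = 0`, whereas regular variation at `x = 1`
  -- forces the limit `1`.
  have h2 : Tendsto (fun t : ℝ => tailFunction ν (t * 1) / tailFunction ν t) atTop (𝓝 0) := by
    refine tendsto_const_nhds.congr' ?_
    filter_upwards [eventually_ge_atTop u] with t ht
    have : tailFunction ν t = 0 :=
      le_antisymm ((tailFunction_antitone ν ht).trans h.le) (tailFunction_nonneg ν t)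
    simp [this]
  have := tendsto_nhds_unique h1 h2
  simp at this

/-! ### Exponential moments of log-excesses -/

theorem lintegral_exp_log_div_eq {ν : Measure ℝ} {u : ℝ} (hu : 0 < u) (θ s : ℝ) {A : Set ℝ}
    (hA : A ⊆ Set.Ioi 0) (hAm : MeasurableSet A) :
    ∫⁻ x in A, ENNReal.ofReal (Real.exp (θ * Real.log (x / u))) ∂ν =
      ENNReal.ofReal (Real.exp (θ * s)) *
        ∫⁻ x in A, ENNReal.ofReal (Real.exp (θ * Real.log (x / (u * Real.exp s)))) ∂ν := by
  rw [← lintegral_const_mul _ (by fun_prop)]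
  refine setLIntegral_congr_fun hAm fun x hx => ?_
  have hx : 0 < x := hA hx
  rw [← ENNReal.ofReal_mul (Real.exp_pos _).le, ← Real.exp_add,
    ← div_div, Real.log_div (x := x / u) (by positivity) (by positivity), Real.log_exp]
  ring_nf

/-- Split at `u * exp s`: the integrand is at most `exp (l * s)` before the cut, and after it the
integral is a rescaled copy of itself. Tail decay by `q` per block makes `C` reproduce itself under
`hC`. Truncation supplies a finite start for the induction, as the full integral is not known to be
finite beforehand. -/
theorem lintegral_Ioc_exp_log_le {ν : Measure ℝ} [IsProbabilityMeasure ν] {l s q C u₀ : ℝ}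
    (hl : 0 < l) (hs : 0 < s) (hu₀ : 0 < u₀) (hC1 : 1 ≤ C)
    (hC : Real.exp (l * s) * (1 + (C - 1) * q) ≤ C)
    (hq : ∀ u, u₀ ≤ u → tailFunction ν (u * Real.exp s) ≤ q * tailFunction ν u) (N : ℕ) :
    ∀ u, u₀ ≤ u →
      ∫⁻ x in Set.Ioc u (u * Real.exp (s * N)),
        ENNReal.ofReal (Real.exp (l * Real.log (x / u))) ∂ν ≤
      ENNReal.ofReal (C * tailFunction ν u) := by
  induction N with
  | zero => intro u _; simp
  | succ N ih =>
    intro u hu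
    have hu0 : 0 < u := hu₀.trans_le hu
    have he : 1 ≤ Real.exp s := Real.one_le_exp hs.le
    have hle : u ≤ u * Real.exp s := le_mul_of_one_le_right hu0.le he
    have hle2 : u * Real.exp s ≤ u * Real.exp (s * (N + 1 : ℕ)) := by
      refine mul_le_mul_of_nonneg_left (Real.exp_le_exp.2 ?_) hu0.le
      push_cast
      nlinarith [mul_nonneg hs.le (Nat.cast_nonneg (α := ℝ) N)]
    rw [← Set.Ioc_union_Ioc_eq_Ioc hle hle2]
    refine (lintegral_union_le _ _ _).trans ?_
    have h1 : ∫⁻ x in Set.Ioc u (u * Real.exp s),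
        ENNReal.ofReal (Real.exp (l * Real.log (x / u))) ∂ν ≤
        ENNReal.ofReal (Real.exp (l * s) *
          (tailFunction ν u - tailFunction ν (u * Real.exp s))) := by
      rw [ENNReal.ofReal_mul (Real.exp_pos _).le, ← measure_Ioc_eq_tailFunction_sub,
        ← setLIntegral_const]
      refine setLIntegral_mono measurable_const fun x hx => ENNReal.ofReal_le_ofReal
        (Real.exp_le_exp.2 (mul_le_mul_of_nonneg_left ?_ hl.le))
      have hx0 : 0 < x := hu0.trans hx.1
      rw [Real.log_le_iff_le_exp (by positivity), div_le_iff₀ hu0, mul_comm]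
      exact hx.2
    have h2 : ∫⁻ x in Set.Ioc (u * Real.exp s) (u * Real.exp (s * (N + 1 : ℕ))),
        ENNReal.ofReal (Real.exp (l * Real.log (x / u))) ∂ν ≤
        ENNReal.ofReal (Real.exp (l * s) * (C * tailFunction ν (u * Real.exp s))) := by
      rw [lintegral_exp_log_div_eq hu0 l s (fun x hx => (by positivity : 0 < u * Real.exp s).trans hx.1)
        measurableSet_Ioc, ENNReal.ofReal_mul (Real.exp_pos _).le]
      have := ih (u * Real.exp s) (hu.trans hle)
      rw [mul_assoc, ← Real.exp_add] at this
      have e : s + s * (N : ℝ) = s * (N + 1 : ℕ) := by push_cast; ring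
      rw [e] at this
      gcongr
    refine (add_le_add h1 h2).trans ?_
    have ht := tailFunction_nonneg ν (u * Real.exp s)
    rw [← ENNReal.ofReal_add (mul_nonneg (Real.exp_pos _).le
      (sub_nonneg.2 (tailFunction_antitone ν hle))) (by positivity)]
    refine ENNReal.ofReal_le_ofReal ?_
    have ht' := tailFunction_nonneg ν u
    calc _ = Real.exp (l * s) *
          (tailFunction ν u + (C - 1) * tailFunction ν (u * Real.exp s)) := by ring
      _ ≤ Real.exp (l * s) * (tailFunction ν u + (C - 1) * (q * tailFunction ν u)) := by
          gcongr
          exact hq u hu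
      _ = Real.exp (l * s) * (1 + (C - 1) * q) * tailFunction ν u := by ring
      _ ≤ C * tailFunction ν u := by gcongr

theorem lintegral_Ioi_exp_log_le {ν : Measure ℝ} [IsProbabilityMeasure ν] {l s q C u₀ : ℝ}
    (hl : 0 < l) (hs : 0 < s) (hu₀ : 0 < u₀) (hC1 : 1 ≤ C)
    (hC : Real.exp (l * s) * (1 + (C - 1) * q) ≤ C)
    (hq : ∀ u, u₀ ≤ u → tailFunction ν (u * Real.exp s) ≤ q * tailFunction ν u)
    {u : ℝ} (hu : u₀ ≤ u) :
    ∫⁻ x in Set.Ioi u, ENNReal.ofReal (Real.exp (l * Real.log (x / u))) ∂ν ≤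
      ENNReal.ofReal (C * tailFunction ν u) := by
  have hu0 : 0 < u := hu₀.trans_le hu
  have hmono : Monotone fun N : ℕ => Set.Ioc u (u * Real.exp (s * N)) := by
    intro M N h
    refine Set.Ioc_subset_Ioc_right ?_
    have : (M : ℝ) ≤ N := by exact_mod_cast h
    gcongr
  have hU : Set.Ioi u = ⋃ N : ℕ, Set.Ioc u (u * Real.exp (s * N)) := by
    ext x
    simp only [Set.mem_Ioi, Set.mem_iUnion, Set.mem_Ioc]
    refine ⟨fun hx => ?_, fun ⟨_, h, _⟩ => h⟩
    have hx0 : 0 < x := hu0.trans hx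
    obtain ⟨N, hN⟩ := exists_nat_ge (Real.log (x / u) / s)
    refine ⟨N, hx, ?_⟩
    rw [div_le_iff₀ hs, Real.log_le_iff_le_exp (by positivity), div_le_iff₀ hu0] at hN
    rwa [mul_comm s, mul_comm u]
  rw [hU, setLIntegral_iUnion_of_directed _ hmono.directed_le]
  exact iSup_le fun N => lintegral_Ioc_exp_log_le hl hs hu₀ hC1 hC hq N u hu

/-- The integrand is at most `1`, so the full half-line can be used from the start. Each split at `u
* exp s` applies an affine map with slope `q * exp (-l * s)` and fixed point `C`; iterating from the
trivial constant `1` brings the bound towards `C`. -/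
theorem lintegral_Ioi_exp_neg_log_le {ν : Measure ℝ} [IsProbabilityMeasure ν]
    {l s q C u₀ : ℝ} (hl : 0 < l) (hs : 0 < s) (hu₀ : 0 < u₀) (hq0 : 0 ≤ q) (hC0 : 0 ≤ C) (hC1 : C ≤ 1)
    (hC : 1 - q + q * Real.exp (-l * s) * C = C) (hq1 : q ≤ 1)
    (hq : ∀ u, u₀ ≤ u → q * tailFunction ν u ≤ tailFunction ν (u * Real.exp s)) (N : ℕ) :
    ∀ u, u₀ ≤ u →
      ∫⁻ x in Set.Ioi u, ENNReal.ofReal (Real.exp (-l * Real.log (x / u))) ∂ν ≤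
      ENNReal.ofReal ((C + (q * Real.exp (-l * s)) ^ N * (1 - C)) * tailFunction ν u) := by
  have hels : Real.exp (-l * s) ≤ 1 := Real.exp_le_one_iff.2 (by nlinarith [mul_pos hl hs])
  have hpw : ∀ {u : ℝ}, 0 < u → ∀ x ∈ Set.Ioi u,
      ENNReal.ofReal (Real.exp (-l * Real.log (x / u))) ≤ 1 := by
    intro u hu0 x hx
    rw [ENNReal.ofReal_le_one, Real.exp_le_one_iff]
    have : 0 ≤ Real.log (x / u) := Real.log_nonneg ((one_le_div hu0).2 (le_of_lt hx))
    nlinarith [mul_nonneg hl.le this]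
  induction N with
  | zero =>
    intro u hu
    have hu0 : 0 < u := hu₀.trans_le hu
    refine (setLIntegral_mono measurable_const (hpw hu0)).trans ?_
    rw [setLIntegral_const, one_mul, measure_Ioi_eq_tailFunction]
    simp
  | succ N ih =>
    intro u hu
    have hu0 : 0 < u := hu₀.trans_le hu
    have he : 1 ≤ Real.exp s := Real.one_le_exp hs.le
    have hle : u ≤ u * Real.exp s := le_mul_of_one_le_right hu0.le he
    rw [← Set.Ioc_union_Ioi_eq_Ioi hle]
    refine (lintegral_union_le _ _ _).trans ?_
    have h1 : ∫⁻ x in Set.Ioc u (u * Real.exp s),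
        ENNReal.ofReal (Real.exp (-l * Real.log (x / u))) ∂ν ≤
        ENNReal.ofReal (tailFunction ν u - tailFunction ν (u * Real.exp s)) := by
      rw [← measure_Ioc_eq_tailFunction_sub, ← setLIntegral_one]
      exact setLIntegral_mono measurable_const fun x hx => hpw hu0 x hx.1
    set D := C + (q * Real.exp (-l * s)) ^ N * (1 - C) with hD
    have hp1 : q * Real.exp (-l * s) ≤ 1 := mul_le_one₀ hq1 (Real.exp_pos _).le hels
    have hp0 : 0 ≤ q * Real.exp (-l * s) := by positivity
    have hD1 : D ≤ 1 := by
      have := mul_le_mul_of_nonneg_right (pow_le_one₀ hp0 hp1 (n := N)) (sub_nonneg.2 hC1)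
      linarith
    have hD0 : 0 ≤ D := by
      have := mul_nonneg (pow_nonneg hp0 N) (sub_nonneg.2 hC1)
      linarith
    have h2 : ∫⁻ x in Set.Ioi (u * Real.exp s),
        ENNReal.ofReal (Real.exp (-l * Real.log (x / u))) ∂ν ≤
        ENNReal.ofReal (Real.exp (-l * s) * (D * tailFunction ν (u * Real.exp s))) := by
      rw [lintegral_exp_log_div_eq hu0 (-l) s
        (Set.Ioi_subset_Ioi (by positivity)) measurableSet_Ioi, ENNReal.ofReal_mul (Real.exp_pos _).le]
      have := ih (u * Real.exp s) (hu.trans hle)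
      gcongr
    refine (add_le_add h1 h2).trans ?_
    have ht := tailFunction_nonneg ν (u * Real.exp s)
    rw [← ENNReal.ofReal_add (sub_nonneg.2 (tailFunction_antitone ν hle)) (by positivity)]
    refine ENNReal.ofReal_le_ofReal ?_
    have hle1 : Real.exp (-l * s) * D ≤ 1 := mul_le_one₀ hels hD0 hD1
    calc _ = tailFunction ν u -
          (1 - Real.exp (-l * s) * D) * tailFunction ν (u * Real.exp s) := by ring
      _ ≤ tailFunction ν u - (1 - Real.exp (-l * s) * D) * (q * tailFunction ν u) :=
          sub_le_sub_left (mul_le_mul_of_nonneg_left (hq u hu) (sub_nonneg.2 hle1)) _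
      _ = (1 - q + q * Real.exp (-l * s) * C +
            (q * Real.exp (-l * s)) ^ (N + 1) * (1 - C)) * tailFunction ν u := by
          rw [hD, pow_succ]; ring
      _ = _ := by rw [hC]

theorem exists_pos_lt_of_hasDerivAt_pos {f : ℝ → ℝ} {f' : ℝ} (hf : HasDerivAt f f' 0)
    (hf' : 0 < f') : ∃ l, 0 < l ∧ f 0 < f l := by
  have h := (hasDerivAt_iff_tendsto_slope.1 hf).eventually (lt_mem_nhds hf')
  have h2 : ∀ᶠ l in 𝓝[>] (0 : ℝ), 0 < slope f 0 l :=
    h.filter_mono (nhdsWithin_mono _ fun x hx => ne_of_gt hx)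
  obtain ⟨l, hl, hl0⟩ := (h2.and self_mem_nhdsWithin).exists
  refine ⟨l, hl0, ?_⟩
  have hl0 : 0 < l := hl0
  rw [slope_def_field, sub_zero, div_pos_iff_of_pos_right hl0] at hl
  linarith

theorem lintegral_exp_mul_sub {ν : Measure ℝ} (θ c u : ℝ) (A : Set ℝ) :
    ∫⁻ x in A, ENNReal.ofReal (Real.exp (θ * (Real.log (x / u) - c))) ∂ν =
      ENNReal.ofReal (Real.exp (-(θ * c))) *
        ∫⁻ x in A, ENNReal.ofReal (Real.exp (θ * Real.log (x / u))) ∂ν := by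
  rw [← lintegral_const_mul _ (by fun_prop)]
  congr with x
  rw [← ENNReal.ofReal_mul (Real.exp_pos _).le, ← Real.exp_add]
  ring_nf

theorem exists_chernoff_bound_upper {ν : Measure ℝ} [IsProbabilityMeasure ν] {α : ℝ}
    (hα : 0 < α) (hRV : IsRegularlyVarying (tailFunction ν) (-α)) {δ : ℝ} (hδ : 0 < δ) :
    ∃ θ ρ u₀ : ℝ, 0 < θ ∧ 0 < ρ ∧ ρ < 1 ∧ 0 < u₀ ∧ ∀ u, u₀ ≤ u →
      ∫⁻ x in Set.Ioi u, ENNReal.ofReal (Real.exp (θ * (Real.log (x / u) - (1 / α + δ)))) ∂ν ≤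
        ENNReal.ofReal ρ * ν (Set.Ioi u) := by
  set s := δ / 2 with hsdef
  have hs : 0 < s := by positivity
  -- A rational number strictly above the limiting ratio `exp (-α * s)`, so that the slope at `l =
  -- 0` below is explicit.
  set q := 1 / (1 + α * s) with hqdef
  have has : 0 < α * s := by positivity
  have hq0 : 0 < q := by positivity
  have hq1 : q < 1 := by rw [hqdef, div_lt_one (by positivity)]; linarith
  have hqe : Real.exp s ^ (-α) < q := by
    rw [← Real.exp_mul, hqdef, mul_neg, Real.exp_neg, ← one_div]
    refine one_div_lt_one_div_of_lt (by positivity) ?_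
    have := Real.add_one_lt_exp has.ne'
    rw [mul_comm s]; linarith
  set c := 1 / α + δ with hc
  -- This is `exp (-(l * c)) * C < 1` cleared of denominators, for the `C` solving the block
  -- recursion. Equality holds at `l = 0`, and the slope there is `(δ - s) * (1 - q) > 0`.
  obtain ⟨l, hl, hfl⟩ : ∃ l, 0 < l ∧ 1 - q <
      Real.exp (l * (c - s)) - q * Real.exp (l * c) := by
    have hd : HasDerivAt (fun l : ℝ => Real.exp (l * (c - s)) - q * Real.exp (l * c))
        (Real.exp (0 * (c - s)) * (1 * (c - s)) - q * (Real.exp (0 * c) * (1 * c))) 0 :=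
      ((hasDerivAt_id (0 : ℝ)).mul_const (c - s)).exp.sub
        (((hasDerivAt_id (0 : ℝ)).mul_const c).exp.const_mul q)
    obtain ⟨l, hl, h⟩ := exists_pos_lt_of_hasDerivAt_pos hd (by
      simp only [zero_mul, Real.exp_zero, one_mul]
      have h1 : c * (1 - q) - s = (δ - s) * (1 - q) := by
        rw [hqdef, hc]; field_simp; ring
      have h2 : 0 < (δ - s) * (1 - q) :=
        mul_pos (by rw [hsdef]; linarith) (by linarith)
      linarith)
    exact ⟨l, hl, by simpa using h⟩
  set E := Real.exp (l * s) with hE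
  have hE1 : 1 ≤ E := Real.one_le_exp (by positivity)
  have hEc : Real.exp (l * (c - s)) * E = Real.exp (l * c) := by
    rw [hE, ← Real.exp_add]; ring_nf
  have hkey : (1 - q) * E < (1 - E * q) * Real.exp (l * c) := by
    have := mul_lt_mul_of_pos_right hfl (zero_lt_one.trans_le hE1)
    rw [sub_mul (Real.exp _), hEc] at this
    linarith
  have hEq : 0 < 1 - E * q := by
    have h0 : 0 < (1 - E * q) * Real.exp (l * c) :=
      (mul_pos (by linarith) (by linarith)).trans hkey
    exact pos_of_mul_pos_left h0 (Real.exp_pos _).le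
  set C := E * (1 - q) / (1 - E * q) with hCdef
  have hC1 : 1 ≤ C := by
    rw [hCdef, le_div_iff₀ hEq]; linarith
  have hCeq : E * (1 + (C - 1) * q) = C := by
    rw [hCdef]; field_simp; ring
  have hev : ∀ᶠ t in atTop, tailFunction ν (t * Real.exp s) / tailFunction ν t < q :=
    (hRV (Real.exp s) (Real.exp_pos s)).eventually (gt_mem_nhds hqe)
  obtain ⟨u₁, hu₁⟩ := eventually_atTop.1 hev
  refine ⟨l, Real.exp (-(l * c)) * C, max u₁ 1, hl, by positivity, ?_, by positivity,
    fun u hu => ?_⟩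
  · rw [Real.exp_neg, inv_mul_lt_one₀ (Real.exp_pos _), hCdef, div_lt_iff₀ hEq]
    linarith
  · rw [lintegral_exp_mul_sub, measure_Ioi_eq_tailFunction, ENNReal.ofReal_mul
      (Real.exp_pos _).le, mul_assoc, ← ENNReal.ofReal_mul (zero_le_one.trans hC1)]
    gcongr
    refine lintegral_Ioi_exp_log_le hl hs (by positivity : 0 < max u₁ 1) hC1 hCeq.le
      (fun v hv => ?_) hu
    exact ((div_lt_iff₀ (tailFunction_pos hRV v)).1 (hu₁ v ((le_max_left _ _).trans hv))).le

theorem exists_chernoff_bound_lower {ν : Measure ℝ} [IsProbabilityMeasure ν] {α : ℝ}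
    (hα : 0 < α) (hRV : IsRegularlyVarying (tailFunction ν) (-α)) {δ : ℝ} (hδ : 0 < δ) :
    ∃ θ ρ u₀ : ℝ, θ < 0 ∧ 0 < ρ ∧ ρ < 1 ∧ 0 < u₀ ∧ ∀ u, u₀ ≤ u →
      ∫⁻ x in Set.Ioi u, ENNReal.ofReal (Real.exp (θ * (Real.log (x / u) - (1 / α - δ)))) ∂ν ≤
        ENNReal.ofReal ρ * ν (Set.Ioi u) := by
  -- The second bound keeps `q = 1 - α * s`, a lower bound for `exp (-α * s)`, positive.
  set s := min (δ / 2) (1 / (2 * α)) with hsdef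
  have hs : 0 < s := by positivity
  have hsδ : s < δ := (min_le_left _ _).trans_lt (by linarith)
  have has : 0 < α * s := by positivity
  have has1 : α * s < 1 := by
    have : s ≤ 1 / (2 * α) := min_le_right _ _
    calc α * s ≤ α * (1 / (2 * α)) := by gcongr
      _ = 1 / 2 := by field_simp
      _ < 1 := by norm_num
  set q := 1 - α * s with hqdef
  have hq0 : 0 < q := by linarith
  have hq1 : q < 1 := by linarith
  have hqe : q < Real.exp s ^ (-α) := by
    rw [← Real.exp_mul]
    have := Real.add_one_lt_exp (x := s * -α) (by nlinarith)
    linarith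
  set c := 1 / α - δ with hc
  obtain ⟨l, hl, hfl⟩ : ∃ l, 0 < l ∧ 1 - q <
      Real.exp (l * (-c)) - q * Real.exp (l * (-(s + c))) := by
    have hd : HasDerivAt (fun l : ℝ => Real.exp (l * (-c)) - q * Real.exp (l * (-(s + c))))
        (Real.exp (0 * (-c)) * (1 * (-c)) -
          q * (Real.exp (0 * (-(s + c))) * (1 * (-(s + c))))) 0 :=
      ((hasDerivAt_id (0 : ℝ)).mul_const (-c)).exp.sub
        (((hasDerivAt_id (0 : ℝ)).mul_const (-(s + c))).exp.const_mul q)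
    obtain ⟨l, hl, h⟩ := exists_pos_lt_of_hasDerivAt_pos hd (by
      simp only [zero_mul, Real.exp_zero, one_mul]
      have h1 : -c - q * -(s + c) = α * s * (δ - s) := by
        rw [hqdef, hc]; field_simp; ring
      rw [h1]
      exact mul_pos has (by linarith))
    exact ⟨l, hl, by simpa using h⟩
  set E := Real.exp (-l * s) with hE
  have hE0 : 0 < E := Real.exp_pos _
  have hE1 : E ≤ 1 := Real.exp_le_one_iff.2 (by nlinarith [mul_pos hl hs])
  have hEq : 0 < 1 - q * E := by nlinarith
  have hEc : Real.exp (l * (-c)) * E = Real.exp (l * (-(s + c))) := by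
    rw [hE, ← Real.exp_add]; ring_nf
  have hinv : Real.exp (l * -c) * Real.exp (l * c) = 1 := by
    rw [← Real.exp_add]; ring_nf; simp
  have hkey : (1 - q) * Real.exp (l * c) < 1 - q * E := by
    have := mul_lt_mul_of_pos_right hfl (Real.exp_pos (l * c))
    rw [← hEc] at this
    calc _ < _ := this
      _ = Real.exp (l * -c) * Real.exp (l * c) * (1 - q * E) := by ring
      _ = _ := by rw [hinv, one_mul]
  set C := (1 - q) / (1 - q * E) with hCdef
  have hC0 : 0 < C := div_pos (by linarith) hEq
  have hC1 : C ≤ 1 := by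
    rw [hCdef, div_le_one hEq]; nlinarith
  have hCeq : 1 - q + q * E * C = C := by
    rw [hCdef]; field_simp; ring
  have hev : ∀ᶠ t in atTop, q < tailFunction ν (t * Real.exp s) / tailFunction ν t :=
    (hRV (Real.exp s) (Real.exp_pos s)).eventually (lt_mem_nhds hqe)
  obtain ⟨u₁, hu₁⟩ := eventually_atTop.1 hev
  have hlim : Tendsto (fun N : ℕ => Real.exp (l * c) * (C + (q * E) ^ N * (1 - C))) atTop
      (𝓝 (Real.exp (l * c) * (C + 0 * (1 - C)))) :=
    (((tendsto_pow_atTop_nhds_zero_of_lt_one (by positivity) (by linarith)).mul_const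
      _).const_add _).const_mul _
  have hlt : Real.exp (l * c) * (C + 0 * (1 - C)) < 1 := by
    rw [zero_mul, add_zero, hCdef, mul_div_assoc', div_lt_one hEq]
    linarith
  -- The fixed point gives a factor strictly below `1`, so finitely many contraction steps suffice.
  obtain ⟨N, hN⟩ := (hlim.eventually (gt_mem_nhds hlt)).exists
  have hD0 : 0 < C + (q * E) ^ N * (1 - C) :=
    add_pos_of_pos_of_nonneg hC0 (mul_nonneg (by positivity) (by linarith))
  refine ⟨-l, Real.exp (l * c) * (C + (q * E) ^ N * (1 - C)), max u₁ 1, by linarith,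
    by positivity, hN, by positivity, fun u hu => ?_⟩
  rw [lintegral_exp_mul_sub, measure_Ioi_eq_tailFunction, ENNReal.ofReal_mul
    (Real.exp_pos _).le, mul_assoc, ← ENNReal.ofReal_mul hD0.le, neg_mul, neg_neg]
  gcongr
  refine lintegral_Ioi_exp_neg_log_le hl hs (by positivity : 0 < max u₁ 1) hq0.le hC0.le hC1
    hCeq hq1.le (fun v hv => ?_) N u hu
  exact ((lt_div_iff₀ (tailFunction_pos hRV v)).1 (hu₁ v ((le_max_left _ _).trans hv))).le

/-! ### Exceedance sets and the Hill statistic -/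

/-- The set of samples in which the entries larger than the `i`-th one are exactly those with
index in `S`, and no other entry equals the `i`-th one. -/
def exceedanceSet {n : ℕ} (i : Fin n) (S : Finset (Fin n)) : Set (Fin n → ℝ) :=
  {x | ∀ j, j ≠ i → if j ∈ S then x i < x j else x j < x i}

theorem measurableSet_exceedanceSet {n : ℕ} (i : Fin n) (S : Finset (Fin n)) :
    MeasurableSet (exceedanceSet i S) := by
  have : exceedanceSet i S =
      ⋂ j, ⋂ _ : j ≠ i, {x | if j ∈ S then x i < x j else x j < x i} := by
    ext x; simp [exceedanceSet]
  rw [this]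
  refine MeasurableSet.iInter fun j => MeasurableSet.iInter fun _ => ?_
  split_ifs
  · exact measurableSet_lt (measurable_pi_apply i) (measurable_pi_apply j)
  · exact measurableSet_lt (measurable_pi_apply j) (measurable_pi_apply i)

theorem eq_filter_of_mem_exceedanceSet {n : ℕ} {i : Fin n} {S : Finset (Fin n)} {x : Fin n → ℝ}
    (hi : i ∉ S) (hx : x ∈ exceedanceSet i S) : S = Finset.univ.filter fun j => x i < x j := by
  ext j
  by_cases hji : j = i
  · subst hji; simp [hi]
  · have h := hx j hji
    split_ifs at h with hj
    · simp [hj, h]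
    · simp [hj, h.le]

/-- A sample determines its `(k+1)`-th largest entry and the indices above it. Disjointness lets the
later union over `(i, S)` cost nothing: the probabilities sum to at most `1`. -/
theorem pairwiseDisjoint_exceedanceSet {n k : ℕ} :
    ({p : Fin n × Finset (Fin n) | p.1 ∉ p.2 ∧ p.2.card = k} : Set _).PairwiseDisjoint
      fun p => exceedanceSet p.1 p.2 := by
  rintro ⟨i, S⟩ ⟨hi, hS⟩ ⟨i', S'⟩ ⟨hi', hS'⟩ hne
  refine Set.disjoint_left.2 fun x hx hx' => hne ?_
  simp only at hi hS hi' hS' hx hx'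
  have e := eq_filter_of_mem_exceedanceSet hi hx
  have e' := eq_filter_of_mem_exceedanceSet hi' hx'
  have key : ∀ {a b : Fin n}, (Finset.univ.filter fun j => x a < x j).card ≤
      (Finset.univ.filter fun j => x b < x j).card → ¬ x a < x b := by
    intro a b hcard hlt
    refine absurd hcard (not_le.2 (Finset.card_lt_card ?_))
    refine Finset.ssubset_iff_subset_ne.2 ⟨fun j hj => ?_, fun h => ?_⟩
    · simp only [Finset.mem_filter, Finset.mem_univ, true_and] at hj ⊢
      exact hlt.trans hj
    · have : b ∈ Finset.univ.filter fun j => x b < x j := by rw [h]; simpa using hlt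
      simp at this
  have hii : i = i' := by
    by_contra hii
    have h := hx i' (Ne.symm hii)
    split_ifs at h
    · exact key (by rw [← e, ← e', hS, hS']) h
    · exact key (by rw [← e, ← e', hS, hS']) h
  subst hii
  rw [Prod.mk.injEq]
  exact ⟨rfl, e.trans e'.symm⟩

theorem lt_of_card_lt_of_mem_exceedanceSet {n : ℕ} {i : Fin n} {S : Finset (Fin n)}
    {x : Fin n → ℝ} (hi : i ∉ S) (hx : x ∈ exceedanceSet i S) {u : ℝ}
    (hu : S.card < (Finset.univ.filter fun j => u < x j).card) : u < x i := by
  by_contra! h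
  refine absurd hu (not_lt.2 (Finset.card_le_card fun j hj => ?_))
  rw [eq_filter_of_mem_exceedanceSet hi hx]
  simp only [Finset.mem_filter, Finset.mem_univ, true_and] at hj ⊢
  exact h.trans_lt hj

theorem exists_hillStatistic_eq {n k : ℕ} {x : Fin n → ℝ} (hx : Function.Injective x)
    (hkn : k < n) :
    ∃ (i : Fin n) (S : Finset (Fin n)), i ∉ S ∧ S.card = k ∧ x ∈ exceedanceSet i S ∧
      hillStatistic x k = 1 / (k : ℝ) * ∑ j ∈ S, Real.log (x j / x i) := by
  set σ := Tuple.sort x with hσ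
  have hmono : StrictMono (x ∘ σ) :=
    (Tuple.monotone_sort x).strictMono_of_injective (hx.comp σ.injective)
  rcases Nat.eq_zero_or_pos k with rfl | hk
  -- For `k = 0` the threshold is the maximum.
  · refine ⟨σ ⟨n - 1, by omega⟩, ∅, by simp, by simp, fun j hj => ?_, by simp [hillStatistic]⟩
    obtain ⟨m, rfl⟩ := σ.surjective j
    simp only [Finset.notMem_empty, if_false]
    refine hmono (lt_of_le_of_ne ?_ fun h => hj (by rw [h]))
    rw [Fin.le_def]
    have := m.2
    simp only
    omega
  set S : Finset (Fin n) := (Finset.Ici ⟨n - k, by omega⟩).map σ.toEmbedding with hS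
  -- Zero-based rank `n - k - 1` carries the order statistic of one-based index `n - k`.
  set i : Fin n := σ ⟨n - k - 1, by omega⟩ with hi
  have hmem : ∀ m, σ m ∈ S ↔ n - k ≤ m := by
    intro m
    simp [hS, Fin.le_def]
  refine ⟨i, S, ?_, ?_, fun j hj => ?_, ?_⟩
  · rw [hi, hmem]
    simp only
    omega
  · rw [hS, Finset.card_map, Fin.card_Ici]
    simp only
    omega
  · obtain ⟨m, rfl⟩ := σ.surjective j
    have hne : (m : ℕ) ≠ n - k - 1 := fun h => hj (by rw [hi]; congr 1; exact Fin.ext h)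
    split_ifs with h
    · rw [hmem] at h
      refine hmono (Fin.lt_def.2 ?_)
      simp only
      omega
    · rw [hmem] at h
      refine hmono (Fin.lt_def.2 ?_)
      simp only
      omega
  · rw [hillStatistic, hS, Finset.sum_map]
    congr 1
    symm
    refine Finset.sum_bij (fun m _ => (m : ℕ) + 1 - (n - k)) ?_ ?_ ?_ ?_
    · intro m hm
      simp only [Finset.mem_Ici, Fin.le_def] at hm
      have := m.2
      simp only [Finset.mem_Icc]
      omega
    · intro m hm m' hm' h
      simp only [Finset.mem_Ici, Fin.le_def] at hm hm'
      exact Fin.ext (by omega)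
    · intro a ha
      simp only [Finset.mem_Icc] at ha
      refine ⟨⟨n - k + a - 1, by omega⟩, ?_, ?_⟩
      · simp only [Finset.mem_Ici, Fin.le_def]
        omega
      · simp only
        omega
    · intro m hm
      simp only [Finset.mem_Ici, Fin.le_def] at hm
      have hm2 := m.2
      have e : n - k + ((m : ℕ) + 1 - (n - k)) = m + 1 := by omega
      rw [e, orderStatistic, dif_pos ⟨by omega, by omega⟩, orderStatistic,
        dif_pos ⟨by omega, by omega⟩]
      rfl

/-! ### Geometric deviation bound for fixed `k` -/

theorem lintegral_pi_mul_prod {n : ℕ} (ν : Measure ℝ) [IsProbabilityMeasure ν] (i : Fin (n + 1))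
    {φ : ℝ → ENNReal} (hφ : Measurable φ) {F : Fin (n + 1) → ℝ → ℝ → ENNReal}
    (hF : ∀ j, Measurable (Function.uncurry (F j))) :
    ∫⁻ x, φ (x i) * ∏ j : Fin n, F (i.succAbove j) (x i) (x (i.succAbove j))
        ∂(Measure.pi fun _ : Fin (n + 1) => ν) =
      ∫⁻ u, φ u * ∏ j : Fin n, ∫⁻ y, F (i.succAbove j) u y ∂ν ∂ν := by
  have hmp := measurePreserving_piFinSuccAbove (fun _ : Fin (n + 1) => ν) i
  have hG : Measurable fun z : ℝ × (Fin n → ℝ) =>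
      φ z.1 * ∏ j : Fin n, F (i.succAbove j) z.1 (z.2 j) := by
    refine (hφ.comp measurable_fst).mul (Finset.measurable_prod _ fun j _ => ?_)
    exact (hF (i.succAbove j)).comp
      (measurable_fst.prodMk ((measurable_pi_apply j).comp measurable_snd))
  have h1 := hmp.lintegral_comp hG
  refine Eq.trans ?_ (h1.trans ?_)
  · rfl
  rw [lintegral_prod _ hG.aemeasurable]
  refine lintegral_congr fun u => ?_
  have hFu : ∀ j, Measurable (F j u) := fun j => (hF j).comp measurable_prodMk_left
  have hm : Measurable fun y : Fin n → ℝ => ∏ j : Fin n, F (i.succAbove j) u (y j) :=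
    Finset.measurable_prod _ fun j _ => (hFu _).comp (measurable_pi_apply j)
  refine (lintegral_const_mul (φ u) hm).trans ?_
  congr 1
  have hind : iIndepFun (fun (j : Fin n) (z : Fin n → ℝ) => F (i.succAbove j) u (z j))
      (Measure.pi fun _ : Fin n => ν) :=
    iIndepFun_pi (μ := fun _ : Fin n => ν) (X := fun j => F (i.succAbove j) u)
      fun j => (hFu _).aemeasurable
  rw [lintegral_prod_eq_prod_lintegral_of_indepFun Finset.univ _ hind
    fun j => (hFu _).comp (measurable_pi_apply j)]
  refine Finset.prod_congr rfl fun j _ => ?_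
  exact (measurePreserving_eval (fun _ : Fin n => ν) j).lintegral_comp (hFu _)

theorem prod_succAbove_ite_pow {n : ℕ} {i : Fin (n + 1)} {S : Finset (Fin (n + 1))} (hi : i ∉ S)
    (f : Fin (n + 1) → ENNReal) :
    ∏ j : Fin n, (if i.succAbove j ∈ S then f (i.succAbove j) else 1) = ∏ j ∈ S, f j := by
  have h := Fin.prod_univ_succAbove (fun j => if j ∈ S then f j else 1) i
  rw [if_neg hi, one_mul] at h
  rw [← h, Finset.prod_ite_mem, Finset.univ_inter]

/-- Chernoff's bound conditionally on `x i = u`. The deviation indicator is dominated by a product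
over `S` of exponentials; the other coordinates factor by independence. Each `j ∈ S` costs `ρ * ν
(Ioi u)` and each other `j` keeps `ν (Iio u)`, so reassembling gives the exceedance probability
times `ρ ^ S.card`. -/
theorem measure_exceedanceSet_inter_le {n : ℕ} (ν : Measure ℝ) [IsProbabilityMeasure ν]
    {θ c ρ u₀ : ℝ}
    (h : ∀ u, u₀ ≤ u →
      ∫⁻ x in Set.Ioi u, ENNReal.ofReal (Real.exp (θ * (Real.log (x / u) - c))) ∂ν ≤
        ENNReal.ofReal ρ * ν (Set.Ioi u))
    {i : Fin n} {S : Finset (Fin n)} (hi : i ∉ S) :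
    (Measure.pi fun _ : Fin n => ν) (exceedanceSet i S ∩
        {x | u₀ ≤ x i ∧ 0 ≤ ∑ j ∈ S, θ * (Real.log (x j / x i) - c)}) ≤
      ENNReal.ofReal ρ ^ S.card * (Measure.pi fun _ : Fin n => ν) (exceedanceSet i S) := by
  obtain _ | n := n
  · exact i.elim0
  set g : ℝ → ℝ → ENNReal := fun u y =>
    ENNReal.ofReal (Real.exp (θ * (Real.log (y / u) - c))) with hg
  have hgm : Measurable (Function.uncurry g) := by
    simp only [hg, Function.uncurry_def]; fun_prop
  have hIoi : ∀ {f : ℝ → ℝ → ENNReal}, Measurable (Function.uncurry f) →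
      Measurable (Function.uncurry fun u y => (Set.Ioi u).indicator (f u) y) := by
    intro f hf
    have : (Function.uncurry fun u y => (Set.Ioi u).indicator (f u) y) =
        {z : ℝ × ℝ | z.1 < z.2}.indicator (Function.uncurry f) := by
      ext ⟨u, y⟩; simp [Set.indicator]
    rw [this]
    exact hf.indicator (measurableSet_lt measurable_fst measurable_snd)
  have hIio : Measurable (Function.uncurry fun u y : ℝ =>
      (Set.Iio u).indicator (fun _ => (1 : ENNReal)) y) := by
    have : (Function.uncurry fun u y : ℝ => (Set.Iio u).indicator (fun _ => (1 : ENNReal)) y) =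
        {z : ℝ × ℝ | z.2 < z.1}.indicator fun _ => 1 := by
      ext ⟨u, y⟩; simp [Set.indicator]
    rw [this]
    exact measurable_const.indicator (measurableSet_lt measurable_snd measurable_fst)
  set F : (ℝ → ℝ → ENNReal) → Fin (n + 1) → ℝ → ℝ → ENNReal := fun f j u y =>
    if j ∈ S then (Set.Ioi u).indicator (f u) y else (Set.Iio u).indicator (fun _ => 1) y with hF
  have hFm : ∀ {f : ℝ → ℝ → ENNReal}, Measurable (Function.uncurry f) → ∀ j,
      Measurable (Function.uncurry (F f j)) := by
    intro f hf j
    by_cases hj : j ∈ S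
    · simpa only [hF, hj, if_true] using hIoi hf
    · simpa only [hF, hj, if_false] using hIio
  have hval : ∀ (f : ℝ → ℝ → ENNReal) (x : Fin (n + 1) → ℝ), x ∈ exceedanceSet i S →
      ∏ j : Fin n, F f (i.succAbove j) (x i) (x (i.succAbove j)) = ∏ j ∈ S, f (x i) (x j) := by
    intro f x hx
    rw [← prod_succAbove_ite_pow hi]
    refine Finset.prod_congr rfl fun j _ => ?_
    have hxj := hx _ (i.succAbove_ne j)
    simp only [hF]
    split_ifs at hxj ⊢ with hj
    · exact Set.indicator_of_mem (s := Set.Ioi (x i)) hxj _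
    · exact Set.indicator_of_mem (s := Set.Iio (x i)) hxj _
  have hval0 : ∀ x : Fin (n + 1) → ℝ, x ∉ exceedanceSet i S →
      ∏ j : Fin n, F (fun _ _ => 1) (i.succAbove j) (x i) (x (i.succAbove j)) = 0 := by
    intro x hx
    simp only [exceedanceSet, Set.mem_ofPred_eq, not_forall] at hx
    obtain ⟨j, hj, hxj⟩ := hx
    obtain ⟨m, rfl⟩ := Fin.exists_succAbove_eq hj
    refine Finset.prod_eq_zero (Finset.mem_univ m) ?_
    simp only [hF]
    split_ifs at hxj ⊢ with hm
    · exact Set.indicator_of_notMem (s := Set.Ioi (x i)) hxj _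
    · exact Set.indicator_of_notMem (s := Set.Iio (x i)) hxj _
  set φ : ℝ → ENNReal := (Set.Ici u₀).indicator fun _ => 1 with hφ
  have hφm : Measurable φ := measurable_const.indicator measurableSet_Ici
  have hφ1 : ∀ u, φ u ≤ 1 := fun u => Set.indicator_le_self' (fun _ _ => zero_le) u
  set μ := Measure.pi fun _ : Fin (n + 1) => ν with hμ
  set A := exceedanceSet i S ∩
    {x | u₀ ≤ x i ∧ 0 ≤ ∑ j ∈ S, θ * (Real.log (x j / x i) - c)} with hA
  have hAm : MeasurableSet A := by
    have h1 : MeasurableSet {x : Fin (n + 1) → ℝ | u₀ ≤ x i} :=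
      measurableSet_le measurable_const (measurable_pi_apply i)
    have h2 : MeasurableSet
        {x : Fin (n + 1) → ℝ | 0 ≤ ∑ j ∈ S, θ * (Real.log (x j / x i) - c)} :=
      measurableSet_le measurable_const (by fun_prop)
    exact (measurableSet_exceedanceSet i S).inter (h1.inter h2)
  calc μ A = ∫⁻ x, A.indicator 1 x ∂μ := (lintegral_indicator_one hAm).symm
    _ ≤ ∫⁻ x, φ (x i) * ∏ j : Fin n, F g (i.succAbove j) (x i) (x (i.succAbove j)) ∂μ := by
        refine lintegral_mono fun x => ?_
        by_cases hx : x ∈ A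
        · rw [Set.indicator_of_mem hx, hval g x hx.1, hφ,
            Set.indicator_of_mem (s := Set.Ici u₀) hx.2.1, one_mul, hg,
            ← ENNReal.ofReal_prod_of_nonneg fun _ _ => (Real.exp_pos _).le, ← Real.exp_sum,
            Pi.one_apply, ENNReal.one_le_ofReal]
          exact Real.one_le_exp hx.2.2
        · rw [Set.indicator_of_notMem hx]
          exact zero_le
    _ = ∫⁻ u, φ u * ∏ j : Fin n, ∫⁻ y, F g (i.succAbove j) u y ∂ν ∂ν :=
        lintegral_pi_mul_prod ν i hφm (hFm hgm)
    _ ≤ ∫⁻ u, ENNReal.ofReal ρ ^ S.card *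
          ∏ j : Fin n, ∫⁻ y, F (fun _ _ => 1) (i.succAbove j) u y ∂ν ∂ν := by
        refine lintegral_mono fun u => ?_
        by_cases hu : u₀ ≤ u
        · rw [← Finset.prod_const, ← prod_succAbove_ite_pow hi, ← Finset.prod_mul_distrib]
          refine (mul_le_of_le_one_left (zero_le) (hφ1 u)).trans ?_
          refine Finset.prod_le_prod' fun j _ => ?_
          simp only [hF]
          split_ifs with hj
          · rw [lintegral_indicator measurableSet_Ioi, lintegral_indicator measurableSet_Ioi,
              setLIntegral_one]
            exact h u hu
          · rw [one_mul]
        · rw [hφ, Set.indicator_of_notMem (s := Set.Ici u₀) hu, zero_mul]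
          exact zero_le
    _ = ENNReal.ofReal ρ ^ S.card *
          ∫⁻ u, 1 * ∏ j : Fin n, ∫⁻ y, F (fun _ _ => 1) (i.succAbove j) u y ∂ν ∂ν := by
        rw [← lintegral_const_mul' _ _ (ENNReal.pow_ne_top ENNReal.ofReal_ne_top)]
        simp only [one_mul]
    _ = ENNReal.ofReal ρ ^ S.card *
          ∫⁻ x, 1 * ∏ j : Fin n, F (fun _ _ => 1) (i.succAbove j) (x i) (x (i.succAbove j)) ∂μ := by
        rw [lintegral_pi_mul_prod ν i (φ := fun _ => 1) measurable_const
          (F := F fun _ _ => 1) (hFm measurable_const)]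
    _ = ENNReal.ofReal ρ ^ S.card * ∫⁻ x, (exceedanceSet i S).indicator 1 x ∂μ := by
        congr 1
        refine lintegral_congr fun x => ?_
        by_cases hx : x ∈ exceedanceSet i S
        · rw [hval (fun _ _ => 1) x hx, Set.indicator_of_mem hx]
          simp
        · rw [hval0 x hx, Set.indicator_of_notMem hx, mul_zero]
    _ = _ := by rw [lintegral_indicator_one (measurableSet_exceedanceSet i S)]

/-- The set of samples of size `n` for which, for the `k` entries exceeding the `(k+1)`-th largest
one, the sum of the centred log-excesses has the sign of `θ`, the threshold being at least `u₀`. -/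
def logExcessDeviationSet (n : ℕ) (θ c u₀ : ℝ) (k : ℕ) : Set (Fin n → ℝ) :=
  {x | ∃ (i : Fin n) (S : Finset (Fin n)), i ∉ S ∧ S.card = k ∧ x ∈ exceedanceSet i S ∧
    u₀ ≤ x i ∧ 0 ≤ ∑ j ∈ S, θ * (Real.log (x j / x i) - c)}

theorem measure_logExcessDeviationSet_le {n : ℕ} (ν : Measure ℝ) [IsProbabilityMeasure ν]
    {θ c ρ u₀ : ℝ}
    (h : ∀ u, u₀ ≤ u →
      ∫⁻ x in Set.Ioi u, ENNReal.ofReal (Real.exp (θ * (Real.log (x / u) - c))) ∂ν ≤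
        ENNReal.ofReal ρ * ν (Set.Ioi u)) (k : ℕ) :
    (Measure.pi fun _ : Fin n => ν) (logExcessDeviationSet n θ c u₀ k) ≤
      ENNReal.ofReal ρ ^ k := by
  classical
  set T : Finset (Fin n × Finset (Fin n)) :=
    Finset.univ.filter fun p => p.1 ∉ p.2 ∧ p.2.card = k with hT
  have hTm : ∀ p ∈ T, p.1 ∉ p.2 ∧ p.2.card = k := fun p hp => (Finset.mem_filter.1 hp).2
  calc _ ≤ (Measure.pi fun _ : Fin n => ν) (⋃ p ∈ T, exceedanceSet p.1 p.2 ∩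
        {x | u₀ ≤ x p.1 ∧ 0 ≤ ∑ j ∈ p.2, θ * (Real.log (x j / x p.1) - c)}) := by
        refine measure_mono ?_
        rintro x ⟨i, S, hi, hS, hx, h1, h2⟩
        exact Set.mem_biUnion (x := (i, S)) (by simp [hT, hi, hS]) ⟨hx, h1, h2⟩
    _ ≤ ∑ p ∈ T, (Measure.pi fun _ : Fin n => ν) (exceedanceSet p.1 p.2 ∩
        {x | u₀ ≤ x p.1 ∧ 0 ≤ ∑ j ∈ p.2, θ * (Real.log (x j / x p.1) - c)}) :=
        measure_biUnion_finset_le _ _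
    _ ≤ ∑ p ∈ T, ENNReal.ofReal ρ ^ k *
          (Measure.pi fun _ : Fin n => ν) (exceedanceSet p.1 p.2) := by
        refine Finset.sum_le_sum fun p hp => ?_
        rw [← (hTm p hp).2]
        exact measure_exceedanceSet_inter_le ν h (hTm p hp).1
    _ = ENNReal.ofReal ρ ^ k *
          (Measure.pi fun _ : Fin n => ν) (⋃ p ∈ T, exceedanceSet p.1 p.2) := by
        rw [measure_biUnion_finset (pairwiseDisjoint_exceedanceSet.subset fun p hp => hTm p hp)
          fun p _ => measurableSet_exceedanceSet _ _, Finset.mul_sum]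
    _ ≤ _ := mul_le_of_le_one_right (zero_le) prob_le_one

theorem abs_hillStatistic_sub_lt {n k : ℕ} {x : Fin n → ℝ} (hx : Function.Injective x)
    (hk : 1 ≤ k) (hkn : k < n) {u₀ θ₁ θ₂ h δ : ℝ} (hθ₁ : 0 < θ₁) (hθ₂ : θ₂ < 0)
    (hu : k < (Finset.univ.filter fun j => u₀ < x j).card)
    (h₁ : x ∉ logExcessDeviationSet n θ₁ (h + δ) u₀ k)
    (h₂ : x ∉ logExcessDeviationSet n θ₂ (h - δ) u₀ k) :
    |hillStatistic x k - h| < δ := by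
  obtain ⟨i, S, hi, hS, hxS, he⟩ := exists_hillStatistic_eq hx hkn
  have hui : u₀ ≤ x i := (lt_of_card_lt_of_mem_exceedanceSet hi hxS (hS ▸ hu)).le
  have hk0 : (0 : ℝ) < k := by exact_mod_cast hk
  have key : ∀ {θ c : ℝ}, x ∉ logExcessDeviationSet n θ c u₀ k →
      θ * (hillStatistic x k - c) < 0 := by
    intro θ c hc
    have hlt : ∑ j ∈ S, θ * (Real.log (x j / x i) - c) < 0 := by
      by_contra! h0
      exact hc ⟨i, S, hi, hS, hxS, hui, h0⟩
    rw [← Finset.mul_sum, Finset.sum_sub_distrib, Finset.sum_const, hS, nsmul_eq_mul] at hlt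
    have e : θ * (hillStatistic x k - c) =
        (θ * (∑ j ∈ S, Real.log (x j / x i) - k * c)) / k := by
      rw [he]; field_simp
    rw [e]
    exact div_neg_of_neg_of_pos hlt hk0
  have k1 := neg_of_mul_neg_right (key h₁) hθ₁.le
  have k2 := pos_of_mul_neg_right (key h₂) hθ₂.le
  rw [abs_lt]
  constructor <;> linarith

/-! ### From the product measure to the random sample -/

theorem nullSingletonClass_of_continuous_cdf {ν : Measure ℝ} [IsProbabilityMeasure ν]
    (hcont : Continuous (cdf ν)) : NullSingletonClass ν := by
  refine ⟨fun a => ?_⟩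
  rw [← measure_cdf ν, StieltjesFunction.measure_singleton,
    hcont.continuousAt.continuousWithinAt.leftLim_eq, sub_self, ENNReal.ofReal_zero]

theorem ae_injective_of_iIndepFun {Ω : Type*} [MeasurableSpace Ω] {P : Measure Ω}
    [IsProbabilityMeasure P] {ν : Measure ℝ} [IsProbabilityMeasure ν] [NullSingletonClass ν]
    {X : ℕ → Ω → ℝ} (hXmeas : ∀ i, Measurable (X i)) (hXindep : iIndepFun X P)
    (hXlaw : ∀ i, P.map (X i) = ν) :
    ∀ᵐ ω ∂P, Function.Injective fun i => X i ω := by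
  have h : ∀ i j, i ≠ j → ∀ᵐ ω ∂P, X i ω ≠ X j ω := by
    intro i j hij
    have hp := (indepFun_iff_map_prod_eq_prod_map_map (hXmeas i).aemeasurable
      (hXmeas j).aemeasurable).1 (hXindep.indepFun hij)
    rw [hXlaw, hXlaw] at hp
    have hd : MeasurableSet {z : ℝ × ℝ | z.1 = z.2} :=
      measurableSet_eq_fun measurable_fst measurable_snd
    have h0 : (ν.prod ν) {z : ℝ × ℝ | z.1 = z.2} = 0 := by
      rw [Measure.measure_prod_null hd]
      refine Eventually.of_forall fun a => ?_
      have : Prod.mk a ⁻¹' {z : ℝ × ℝ | z.1 = z.2} = {a} := by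
        ext b; simp [eq_comm]
      exact (congrArg ν this).trans (measure_singleton a)
    rw [← hp, Measure.map_apply ((hXmeas i).prodMk (hXmeas j)) hd] at h0
    rw [ae_iff]
    simpa using h0
  have h' : ∀ᵐ ω ∂P, ∀ i j, i ≠ j → X i ω ≠ X j ω := by
    simp only [ae_all_iff]
    exact h
  filter_upwards [h'] with ω hω i j hij
  by_contra hne
  exact hω i j hne hij

theorem tendstoInMeasure_card_lt_div {Ω : Type*} [MeasurableSpace Ω] {P : Measure Ω}
    [IsProbabilityMeasure P] {ν : Measure ℝ} [IsProbabilityMeasure ν]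
    {X : ℕ → Ω → ℝ} (hXmeas : ∀ i, Measurable (X i)) (hXindep : iIndepFun X P)
    (hXlaw : ∀ i, P.map (X i) = ν) (u : ℝ) :
    TendstoInMeasure P (fun (n : ℕ) ω =>
      ((Finset.univ.filter fun j : Fin n => u < X j ω).card : ℝ) / n) atTop
      fun _ => tailFunction ν u := by
  set f : ℝ → ℝ := (Set.Ioi u).indicator 1 with hf
  have hfm : Measurable f := measurable_one.indicator measurableSet_Ioi
  have hfb : ∀ y, ‖f y‖ ≤ 1 := by
    intro y
    by_cases hy : u < y <;> simp [hf, hy]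
  have hid : ∀ i, IdentDistrib (X i) (X 0) P P := fun i =>
    ⟨(hXmeas i).aemeasurable, (hXmeas 0).aemeasurable, by rw [hXlaw, hXlaw]⟩
  have hmean : ∫ ω, (f ∘ X 0) ω ∂P = tailFunction ν u := by
    have : ∫ ω, f (X 0 ω) ∂P = ∫ y, f y ∂ν := by
      rw [← hXlaw 0, integral_map (hXmeas 0).aemeasurable hfm.aestronglyMeasurable]
    simp only [Function.comp_apply]
    rw [this, hf, integral_indicator_one measurableSet_Ioi, measureReal_def,
      measure_Ioi_eq_tailFunction, ENNReal.toReal_ofReal (tailFunction_nonneg ν u)]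
  have hslln := strong_law_ae_real (μ := P) (fun i => f ∘ X i)
    (Integrable.of_bound (hfm.comp (hXmeas 0)).aestronglyMeasurable 1
      (Eventually.of_forall fun ω => hfb _))
    (fun i j hij => (hXindep.indepFun hij).comp hfm hfm) fun i => (hid i).comp hfm
  have hcard : ∀ (n : ℕ) ω, ((Finset.univ.filter fun j : Fin n => u < X j ω).card : ℝ) =
      ∑ i ∈ Finset.range n, (f ∘ X i) ω := by
    intro n ω
    rw [Finset.sum_range fun i => (f ∘ X i) ω, Finset.card_filter]
    push_cast
    refine Finset.sum_congr rfl fun j _ => ?_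
    simp [hf, Set.indicator_apply]
  simp only [hcard, ← hmean]
  refine tendstoInMeasure_of_tendsto_ae (fun n => ?_) hslln
  exact ((Finset.measurable_fun_sum _ fun i _ => hfm.comp (hXmeas i)).div_const
    _).aestronglyMeasurable

theorem measure_sample_mem_le {Ω : Type*} [MeasurableSpace Ω] {P : Measure Ω}
    [IsProbabilityMeasure P] {ν : Measure ℝ} {X : ℕ → Ω → ℝ} (hXmeas : ∀ i, Measurable (X i))
    (hXindep : iIndepFun X P) (hXlaw : ∀ i, P.map (X i) = ν) (n : ℕ) (A : Set (Fin n → ℝ)) :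
    P {ω | (fun i : Fin n => X i ω) ∈ A} ≤ (Measure.pi fun _ : Fin n => ν) A := by
  have hind : iIndepFun (fun i : Fin n => X i) P := hXindep.precomp Fin.val_injective
  have h := (iIndepFun_iff_map_fun_eq_pi_map fun i : Fin n => (hXmeas i).aemeasurable).1 hind
  simp only [hXlaw] at h
  rw [← h]
  have hm : Measurable fun ω (i : Fin n) => X i ω := measurable_pi_lambda _ fun i => hXmeas i
  -- Only an inequality is needed, so `A` need not be measurable.
  exact Measure.le_map_apply hm.aemeasurable A

/-- A union bound over all `k ≥ M` sums to a geometric tail free of `n`, which removes any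
dependence of `k n` on the data. -/
theorem measure_exists_mem_logExcessDeviationSet_le {Ω : Type*} [MeasurableSpace Ω]
    {P : Measure Ω} [IsProbabilityMeasure P] {ν : Measure ℝ} [IsProbabilityMeasure ν]
    {X : ℕ → Ω → ℝ} (hXmeas : ∀ i, Measurable (X i)) (hXindep : iIndepFun X P)
    (hXlaw : ∀ i, P.map (X i) = ν) {θ c ρ u₀ : ℝ}
    (h : ∀ u, u₀ ≤ u →
      ∫⁻ x in Set.Ioi u, ENNReal.ofReal (Real.exp (θ * (Real.log (x / u) - c))) ∂ν ≤
        ENNReal.ofReal ρ * ν (Set.Ioi u)) (n M : ℕ) :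
    P {ω | ∃ k, M ≤ k ∧ (fun i : Fin n => X i ω) ∈ logExcessDeviationSet n θ c u₀ k} ≤
      ENNReal.ofReal ρ ^ M * (1 - ENNReal.ofReal ρ)⁻¹ := by
  calc _ ≤ P (⋃ k : ℕ, {ω | (fun i : Fin n => X i ω) ∈
          logExcessDeviationSet n θ c u₀ (M + k)}) := by
        refine measure_mono ?_
        rintro ω ⟨k, hk, hω⟩
        obtain ⟨m, rfl⟩ := Nat.exists_eq_add_of_le hk
        exact Set.mem_iUnion.2 ⟨m, hω⟩
    _ ≤ ∑' k : ℕ, P {ω | (fun i : Fin n => X i ω) ∈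
          logExcessDeviationSet n θ c u₀ (M + k)} := measure_iUnion_le _
    _ ≤ ∑' k : ℕ, ENNReal.ofReal ρ ^ (M + k) :=
        ENNReal.tsum_le_tsum fun k => (measure_sample_mem_le hXmeas hXindep hXlaw n _).trans
          (measure_logExcessDeviationSet_le ν h (M + k))
    _ = _ := by simp only [pow_add, ENNReal.tsum_mul_left, ENNReal.tsum_geometric]

theorem tendsto_ofReal_pow_mul_inv {ρ : ℝ} (hρ : ρ < 1) :
    Tendsto (fun M : ℕ => ENNReal.ofReal ρ ^ M * (1 - ENNReal.ofReal ρ)⁻¹) atTop (𝓝 0) := by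
  have h1 : ENNReal.ofReal ρ < 1 := by simpa using hρ
  have h2 : (1 - ENNReal.ofReal ρ)⁻¹ ≠ ⊤ := ENNReal.inv_ne_top.2 (tsub_pos_of_lt h1).ne'
  simpa using ENNReal.Tendsto.mul_const
    (ENNReal.tendsto_pow_atTop_nhds_zero_of_lt_one h1) (Or.inr h2)

/-! ### Consistency -/

theorem mainTheorem2 {Ω : Type*} [MeasurableSpace Ω] (P : Measure Ω) [IsProbabilityMeasure P]
    (ν : Measure ℝ) [IsProbabilityMeasure ν]
    (hcont : Continuous (cdf ν)) (hsupp : ν (Set.Iio 1) = 0)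
    (α : ℝ) (hα : 0 < α) (hRV : IsRegularlyVarying (tailFunction ν) (-α))
    (X : ℕ → Ω → ℝ) (hXmeas : ∀ i, Measurable (X i)) (hXindep : iIndepFun X P)
    (hXlaw : ∀ i, P.map (X i) = ν)
    (k : ℕ → Ω → ℕ) (hkmeas : ∀ n, Measurable (k n)) (hk : IsRandomIntermediate P k) :
    TendstoInMeasure P
      (fun (n : ℕ) (ω : Ω) => hillEstimator (fun i : Fin n => X i ω) (k n ω))
      atTop (fun _ => α) := by
  rw [tendstoInMeasure_iff_dist]
  intro ε hε
  have hinv : ContinuousAt (fun h : ℝ => h⁻¹) (1 / α) := continuousAt_inv₀ (by positivity)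
  obtain ⟨δ, hδ, hδε⟩ := Metric.continuousAt_iff.1 hinv ε hε
  rw [one_div, inv_inv] at hδε
  obtain ⟨θ₁, ρ₁, u₁, hθ₁, -, hρ₁, -, hb₁⟩ := exists_chernoff_bound_upper hα hRV hδ
  obtain ⟨θ₂, ρ₂, u₂, hθ₂, -, hρ₂, -, hb₂⟩ := exists_chernoff_bound_lower hα hRV hδ
  set u₀ := max u₁ u₂ with hu₀
  replace hb₁ := fun u (hu : u₀ ≤ u) => hb₁ u ((le_max_left _ _).trans hu)
  replace hb₂ := fun u (hu : u₀ ≤ u) => hb₂ u ((le_max_right _ _).trans hu)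
  set p := tailFunction ν u₀ with hp
  have hp0 : 0 < p := tailFunction_pos hRV u₀
  have : NullSingletonClass ν := nullSingletonClass_of_continuous_cdf hcont
  have hinj := ae_injective_of_iIndepFun hXmeas hXindep hXlaw
  have hcard := tendstoInMeasure_iff_dist.1
    (tendstoInMeasure_card_lt_div hXmeas hXindep hXlaw u₀) (p / 2) (by positivity)
  -- The bound `p / 2` puts `k n` below the number of exceedances of `u₀`, which is more than `n * p
  -- / 2`; the bound `1` gives `k n < n`.
  have hkn := tendstoInMeasure_iff_dist.1 hk.tendsto_zero (min (p / 2) 1) (by positivity)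
  rw [ENNReal.tendsto_nhds_zero]
  intro η hη
  have hη2 : 0 < η / 2 := ENNReal.half_pos hη.ne'
  have hM := (tendsto_ofReal_pow_mul_inv hρ₁).add (tendsto_ofReal_pow_mul_inv hρ₂)
  rw [add_zero] at hM
  -- `M` is fixed before `n`, which is possible because the deviation bounds are uniform in `n`.
  obtain ⟨M, hM⟩ := ((ENNReal.tendsto_nhds_zero.1 hM) (η / 2) hη2).exists
  have hrest := ((hk.tendsto_infty M).add hkn).add hcard
  simp only [add_zero] at hrest
  filter_upwards [(ENNReal.tendsto_nhds_zero.1 hrest) (η / 2) hη2, eventually_gt_atTop 0]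
    with n hn hn0
  have hn0' : (0 : ℝ) < n := by exact_mod_cast hn0
  set B₁ := {ω | ∃ m, M ≤ m ∧
    (fun i : Fin n => X i ω) ∈ logExcessDeviationSet n θ₁ (1 / α + δ) u₀ m} with hB₁
  set B₂ := {ω | ∃ m, M ≤ m ∧
    (fun i : Fin n => X i ω) ∈ logExcessDeviationSet n θ₂ (1 / α - δ) u₀ m} with hB₂
  set D₁ := {ω | k n ω ≤ M} with hD₁
  set D₂ := {ω | min (p / 2) 1 ≤ dist ((k n ω : ℝ) / n) 0} with hD₂
  set D₃ := {ω | p / 2 ≤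
    dist (((Finset.univ.filter fun j : Fin n => u₀ < X j ω).card : ℝ) / n) p} with hD₃
  have hP₁ : P B₁ ≤ _ :=
    measure_exists_mem_logExcessDeviationSet_le hXmeas hXindep hXlaw hb₁ n M
  have hP₂ : P B₂ ≤ _ :=
    measure_exists_mem_logExcessDeviationSet_le hXmeas hXindep hXlaw hb₂ n M
  calc P {ω | ε ≤ dist (hillEstimator (fun i : Fin n => X i ω) (k n ω)) α}
      ≤ P (((D₁ ∪ D₂) ∪ D₃) ∪ (B₁ ∪ B₂)) := by
        refine measure_mono_ae ?_
        filter_upwards [hinj] with ω hω hbad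
        by_contra hgood
        have hgood : ω ∉ ((D₁ ∪ D₂) ∪ D₃) ∪ (B₁ ∪ B₂) := hgood
        simp only [Set.mem_union, not_or] at hgood
        obtain ⟨⟨⟨h1, h2⟩, h3⟩, h4, h5⟩ := hgood
        have h1 : M < k n ω := not_le.1 h1
        have h2 : dist ((k n ω : ℝ) / n) 0 < min (p / 2) 1 := not_le.1 h2
        have h3 : dist (((Finset.univ.filter fun j : Fin n => u₀ < X j ω).card : ℝ) / n) p <
            p / 2 := not_le.1 h3
        rw [Real.dist_0_eq_abs, abs_of_nonneg (by positivity), lt_min_iff] at h2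
        rw [Real.dist_eq, abs_lt] at h3
        have hlt : k n ω < n := by
          have := (div_lt_one hn0').1 h2.2
          exact_mod_cast this
        have hcn : k n ω < (Finset.univ.filter fun j : Fin n => u₀ < X j ω).card := by
          have : (k n ω : ℝ) / n <
              ((Finset.univ.filter fun j : Fin n => u₀ < X j ω).card : ℝ) / n := by
            linarith [h2.1, h3.1]
          exact_mod_cast (div_lt_div_iff_of_pos_right hn0').1 this
        have habs := abs_hillStatistic_sub_lt (x := fun i : Fin n => X i ω)
          (hω.comp Fin.val_injective) (by omega) hlt hθ₁ hθ₂ hcn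
          (fun h => h4 ⟨_, h1.le, h⟩) fun h => h5 ⟨_, h1.le, h⟩
        refine absurd hbad (not_le.2 ?_)
        rw [one_div] at habs
        exact hδε (by rwa [Real.dist_eq])
    _ ≤ ((P D₁ + P D₂) + P D₃) + (P B₁ + P B₂) := by
        refine (measure_union_le _ _).trans (add_le_add ?_ (measure_union_le _ _))
        exact (measure_union_le _ _).trans (by gcongr; exact measure_union_le _ _)
    _ ≤ η / 2 + η / 2 := add_le_add hn ((add_le_add hP₁ hP₂).trans hM)
    _ = η := ENNReal.add_halves η
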